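/- Let a finite simple graph $G$ with $n$ vertices and $m$ edges be called unicyclic if it has exactly one cycle ($G$ need not be connected). Consider the following leaf-removal algorithm. Its input is $G$, with vertices numbered $0,\dots,n-1$ and given by adjacency lists. It initializes a boolean array marking all vertices as present, computes all degrees, puts all leaves (vertices of degree $1$) into a queue, and sets $M\leftarrow\emptyset$. While the queue is not empty it takes out its first vertex $v$; if $v$ is still present and is a leaf of the current graph, with only neighbor $u$, it removes $v$ and $u$ from the graph, adds the edge $vu$ to $M$, and appends to the queue all remaining neighbors of $u$ that have just become leaves. At the end it answers "yes" if no vertex is left, and "no" otherwise. There is an absolute constant $C$ such that for every unicyclic graph $G$ with $n$ vertices and $m$ edges, and for every ordering of its adjacency lists, this algorithm, executed on a unit-cost random access machine, halts and answers "yes" if $G$ has exactly one perfect matching and "no" otherwise. The number of its steps is at most $C(n+m)$, and at most $Cm$ if $G$ has no isolated vertices (in particular if $G$ is connected); that is, for unicyclic graphs without isolated vertices the algorithm decides in $O(m)$ time whether there is a unique perfect matching. -/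

import Mathlib

namespace UPM

/-! A unit-cost random access machine with structured control flow. -/

/-- Names of the registers. Each register holds one natural number. -/
inductive Reg
  | size | zero | one | i | j | k | a | b | d | head | tail | v | u | w | cnt | ans
  deriving DecidableEq

/-- Names of the arrays. Each cell of an array holds one natural number. -/
inductive Arr
  | off | nbr | alive | deg | queue | matchL | matchR
  deriving DecidableEq

/-- The memory of the machine. -/
structure Memory where
  reg : Reg → ℕ
  arr : Arr → ℕ → ℕ

/-- Write a number into a register. -/
def Memory.setReg (s : Memory) (x : Reg) (c : ℕ) : Memory :=
  { s with reg := Function.update s.reg x c }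

/-- Write a number into one cell of an array. -/
def Memory.setArr (s : Memory) (A : Arr) (p c : ℕ) : Memory :=
  { s with arr := Function.update s.arr A (Function.update (s.arr A) p c) }

/-- The tests on which a program may branch: comparisons of two registers. -/
inductive Guard
  | lt (x y : Reg)
  | eq (x y : Reg)

/-- The truth of a test in a memory state. -/
def Guard.Holds (s : Memory) : Guard → Prop
  | .lt x y => s.reg x < s.reg y
  | .eq x y => s.reg x = s.reg y

/-- Programs: elementary instructions, composition, branching and loops. -/
inductive Prog
  /-- no operation -/
  | skip
  /-- `x := c` -/
  | const (x : Reg) (c : ℕ)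
  /-- `x := y + z` -/
  | add (x y z : Reg)
  /-- `x := y - z`, cut off at zero -/
  | sub (x y z : Reg)
  /-- `x := A[y]` -/
  | load (x : Reg) (A : Arr) (y : Reg)
  /-- `A[x] := y` -/
  | store (A : Arr) (x y : Reg)
  | seq (p q : Prog)
  | branch (g : Guard) (p q : Prog)
  | loop (g : Guard) (p : Prog)

/-- `Exec p s t s'`: started in `s`, the program `p` halts after exactly `t` steps in `s'`.
Every elementary instruction and every evaluation of a test is one step. -/
inductive Exec : Prog → Memory → ℕ → Memory → Prop
  | skip (s) : Exec .skip s 1 s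
  | const (s x c) : Exec (.const x c) s 1 (s.setReg x c)
  | add (s x y z) : Exec (.add x y z) s 1 (s.setReg x (s.reg y + s.reg z))
  | sub (s x y z) : Exec (.sub x y z) s 1 (s.setReg x (s.reg y - s.reg z))
  | load (s x A y) : Exec (.load x A y) s 1 (s.setReg x (s.arr A (s.reg y)))
  | store (s A x y) : Exec (.store A x y) s 1 (s.setArr A (s.reg x) (s.reg y))
  | seq {p q s₁ s₂ s₃ t₁ t₂} (h₁ : Exec p s₁ t₁ s₂) (h₂ : Exec q s₂ t₂ s₃) :
      Exec (.seq p q) s₁ (t₁ + t₂) s₃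
  | branch_true {g p q s s' t} (hg : g.Holds s) (h : Exec p s t s') :
      Exec (.branch g p q) s (1 + t) s'
  | branch_false {g p q s s' t} (hg : ¬ g.Holds s) (h : Exec q s t s') :
      Exec (.branch g p q) s (1 + t) s'
  | loop_true {g p s₁ s₂ s₃ t₁ t₂} (hg : g.Holds s₁) (h₁ : Exec p s₁ t₁ s₂)
      (h₂ : Exec (.loop g p) s₂ t₂ s₃) : Exec (.loop g p) s₁ (1 + t₁ + t₂) s₃
  | loop_false {g p s} (hg : ¬ g.Holds s) : Exec (.loop g p) s 1 s

/-- The machine is deterministic: the run, its number of steps and its result are determined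
by the program and the initial memory. -/
theorem Exec.deterministic {p : Prog} {s s₁ s₂ : Memory} {t₁ t₂ : ℕ}
    (h₁ : Exec p s t₁ s₁) (h₂ : Exec p s t₂ s₂) : t₁ = t₂ ∧ s₁ = s₂ := by
  induction h₁ generalizing t₂ s₂ with
  | skip | const | add | sub | load | store => cases h₂; exact ⟨rfl, rfl⟩
  | seq _ _ ih₁ ih₂ =>
    cases h₂ with
    | seq k₁ k₂ =>
      obtain ⟨rfl, rfl⟩ := ih₁ k₁
      obtain ⟨rfl, rfl⟩ := ih₂ k₂
      exact ⟨rfl, rfl⟩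
  | branch_true hg _ ih =>
    cases h₂ with
    | branch_true _ k => obtain ⟨rfl, rfl⟩ := ih k; exact ⟨rfl, rfl⟩
    | branch_false kg _ => exact absurd hg kg
  | branch_false hg _ ih =>
    cases h₂ with
    | branch_true kg _ => exact absurd kg hg
    | branch_false _ k => obtain ⟨rfl, rfl⟩ := ih k; exact ⟨rfl, rfl⟩
  | loop_true hg _ _ ih₁ ih₂ =>
    cases h₂ with
    | loop_true _ k₁ k₂ =>
      obtain ⟨rfl, rfl⟩ := ih₁ k₁
      obtain ⟨rfl, rfl⟩ := ih₂ k₂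
      exact ⟨rfl, rfl⟩
    | loop_false kg => exact absurd hg kg
  | loop_false hg =>
    cases h₂ with
    | loop_true kg _ _ => exact absurd kg hg
    | loop_false _ => exact ⟨rfl, rfl⟩

/-- Sequential composition of a list of programs. -/
def block : List Prog → Prog
  | [] => .skip
  | [p] => p
  | p :: q :: l => .seq p (block (q :: l))

/-! The leaf-removal algorithm. The vertices are `0, …, n - 1`, where `n` is held in `size`;
the neighbours of `v` are listed in `nbr[off[v]], …, nbr[off[v + 1] - 1]`.
`alive[v]` is `1` if `v` still belongs to the current graph and `0` if it was removed. -/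

/-- For all vertices `i`: `alive[i] := 1` and `deg[i] :=` the degree of `i`. -/
def initVertices : Prog := block [
  .const .i 0,
  .loop (.lt .i .size) (block [
    .store .alive .i .one,
    .load .a .off .i,
    .add .j .i .one,
    .load .b .off .j,
    .sub .d .b .a,
    .store .deg .i .d,
    .add .i .i .one])]

/-- Put all leaves of the input graph into the queue,
whose entries are `queue[head], …, queue[tail - 1]`. -/
def initQueue : Prog := block [
  .const .head 0,
  .const .tail 0,
  .const .i 0,
  .loop (.lt .i .size) (block [
    .load .d .deg .i,
    .branch (.eq .d .one)
      (block [.store .queue .tail .i, .add .tail .tail .one])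
      .skip,
    .add .i .i .one])]

/-- Find the only remaining neighbour `u` of the leaf `v`. -/
def findNeighbour : Prog := block [
  .load .k .off .v,
  .load .u .nbr .k,
  .load .a .alive .u,
  .loop (.eq .a .zero) (block [
    .add .k .k .one,
    .load .u .nbr .k,
    .load .a .alive .u])]

/-- Remove `v` and `u` from the vertex set. -/
def removePair : Prog := block [
  .store .alive .v .zero,
  .store .alive .u .zero]

/-- Add the edge `vu` to the matching, which consists of the `cnt` edges
`matchL[0] matchR[0], …, matchL[cnt - 1] matchR[cnt - 1]`. -/
def recordPair : Prog := block [
  .store .matchL .cnt .v,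
  .store .matchR .cnt .u,
  .add .cnt .cnt .one]

/-- Update the degrees of the remaining neighbours `w` of `u`,
and append those that have become leaves to the queue. -/
def addNewLeaves : Prog := block [
  .load .k .off .u,
  .add .j .u .one,
  .load .b .off .j,
  .loop (.lt .k .b) (block [
    .load .w .nbr .k,
    .load .a .alive .w,
    .branch (.eq .a .one)
      (block [
        .load .d .deg .w,
        .sub .d .d .one,
        .store .deg .w .d,
        .branch (.eq .d .one)
          (block [.store .queue .tail .w, .add .tail .tail .one])
          .skip])
      .skip,
    .add .k .k .one])]

/-- While the queue is not empty, take its first vertex `v`; if `v` still belongs to the graph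
and is a leaf of it, remove `v` together with its neighbour. -/
def mainLoop : Prog :=
  .loop (.lt .head .tail) (block [
    .load .v .queue .head,
    .add .head .head .one,
    .load .a .alive .v,
    .branch (.eq .a .one)
      (block [
        .load .d .deg .v,
        .branch (.eq .d .one)
          (block [findNeighbour, removePair, recordPair, addNewLeaves])
          .skip])
      .skip])

/-- `ans := 1` if no vertex is left, and `ans := 0` otherwise. -/
def testEmpty : Prog := block [
  .const .ans 1,
  .const .i 0,
  .loop (.lt .i .size) (block [
    .load .a .alive .i,
    .branch (.eq .a .one) (.const .ans 0) .skip,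
    .add .i .i .one])]

/-- The whole algorithm. -/
def algorithm : Prog := block [
  .const .zero 0,
  .const .one 1,
  initVertices,
  initQueue,
  .const .cnt 0,
  mainLoop,
  testEmpty]

/-- The memory `s` holds the graph `G` by adjacency lists, each in an arbitrary order and
without repetitions, stored one after the other. Everything else in the memory is arbitrary. -/
structure IsInput {n : ℕ} (G : SimpleGraph (Fin n)) (s : Memory) : Prop where
  size_eq : s.reg .size = n
  off_zero : s.arr .off 0 = 0
  off_le : ∀ v : Fin n, s.arr .off v ≤ s.arr .off (v + 1)
  nbr_bijOn : ∀ v : Fin n,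
    Set.BijOn (s.arr .nbr) (Set.Ico (s.arr .off v) (s.arr .off (v + 1)))
      ((fun w : Fin n => (w : ℕ)) '' G.neighborSet v)

/-- `G` has exactly one cycle, cycles being regarded as subgraphs. -/
def IsUnicyclic {V : Type*} (G : SimpleGraph V) : Prop :=
  ∃! H : G.Subgraph, ∃ (v : V) (p : G.Walk v v), p.IsCycle ∧ p.toSubgraph = H

/-- `G` has exactly one perfect matching. -/
def HasUniquePerfectMatching {V : Type*} (G : SimpleGraph V) : Prop :=
  ∃! M : G.Subgraph, M.IsPerfectMatching

end UPM

/-! Correctness. A leaf `v` of the current graph must be matched with its only neighbour `u`, so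
deleting both preserves uniqueness of the perfect matching (`existsUnique_isMatchingMap_erase`). The
queue always contains every current leaf; stale entries are harmless, since they are tested when
taken out. Hence a leafless graph, induced by some set `S`, remains at the end. If `S` is empty, its
only matching is the empty one. Otherwise suppose a perfect matching exists: all degrees are
positive and different from one, hence at least two. A unicyclic graph is a forest plus one edge, so
the degrees in `S` sum to at most `2 * S.card` (`IsUnicyclic.sum_card_nbrsIn_le`) and are all equal
to two. The unmatched edges then form a second perfect matching.

Running time. Besides constant work per vertex and per queue entry, the algorithm scans the
adjacency lists of removed vertices only, each of them once. New queue entries are charged to the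
list being scanned, and all lists together have `2m` cells. `runs_loop` turns this amortization into
a potential that pays for every step. -/

namespace UPM

/-! ### Perfect matchings as involutions, and degree sums in unicyclic graphs. -/

section Matchings

variable {V : Type*}

/-- `f` exchanges the ends of the edges of a perfect matching of the subgraph induced by `S`,
and fixes all other vertices. -/
structure IsMatchingMap (G : SimpleGraph V) (S : Finset V) (f : V → V) : Prop where
  mem : ∀ v ∈ S, f v ∈ S
  adj : ∀ v ∈ S, G.Adj v (f v)
  invol : ∀ v ∈ S, f (f v) = v
  fixed : ∀ v ∉ S, f v = v

open Classical in
/-- The neighbours of `v` that belong to `S`. -/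
noncomputable def nbrsIn (G : SimpleGraph V) (S : Finset V) (v : V) : Finset V :=
  S.filter (G.Adj v)

theorem mem_nbrsIn {G : SimpleGraph V} {S : Finset V} {v w : V} :
    w ∈ nbrsIn G S v ↔ w ∈ S ∧ G.Adj v w := by
  simp [nbrsIn]

/-- The matching map of a perfect matching given as a subgraph, and back. -/
theorem hasUniquePerfectMatching_iff [Fintype V] (G : SimpleGraph V) :
    HasUniquePerfectMatching G ↔ ∃! f, IsMatchingMap G Finset.univ f := by
  have toMap : ∀ M : G.Subgraph, M.IsPerfectMatching →
      ∃ f, IsMatchingMap G Finset.univ f ∧ ∀ v w, M.Adj v w ↔ f v = w := by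
    intro M hM
    rw [SimpleGraph.Subgraph.isPerfectMatching_iff] at hM
    choose f hf hu using hM
    have key : ∀ v w, M.Adj v w ↔ f v = w :=
      fun v w => ⟨fun h => (hu v w h).symm, fun h => h ▸ hf v⟩
    exact ⟨f, ⟨fun _ _ => Finset.mem_univ _, fun v _ => (hf v).adj_sub,
      fun v _ => (key _ _).1 (hf v).symm, fun v hv => absurd (Finset.mem_univ v) hv⟩, key⟩
  have toSub : ∀ f, IsMatchingMap G Finset.univ f →
      ∃ M : G.Subgraph, M.IsPerfectMatching ∧ ∀ v w, M.Adj v w ↔ f v = w := by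
    intro f hf
    refine ⟨{ verts := Set.univ, Adj := fun v w => f v = w, adj_sub := ?_,
              edge_vert := fun _ => Set.mem_univ _, symm := ⟨?_⟩ }, ?_, fun _ _ => Iff.rfl⟩
    · rintro v w rfl
      exact hf.adj v (Finset.mem_univ _)
    · rintro v w rfl
      exact hf.invol v (Finset.mem_univ _)
    · rw [SimpleGraph.Subgraph.isPerfectMatching_iff]
      exact fun v => ⟨f v, rfl, fun w hw => Eq.symm hw⟩
  constructor
  · rintro ⟨M, hM, hu⟩
    obtain ⟨f, hf, hMf⟩ := toMap M hM
    refine ⟨f, hf, fun g hg => ?_⟩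
    obtain ⟨N, hN, hNg⟩ := toSub g hg
    obtain rfl := hu N hN
    funext v
    exact (hNg v _).1 ((hMf v _).2 rfl)
  · rintro ⟨f, hf, hu⟩
    obtain ⟨M, hM, hMf⟩ := toSub f hf
    refine ⟨M, hM, fun N hN => ?_⟩
    obtain ⟨g, hg, hNg⟩ := toMap N hN
    obtain rfl := hu g hg
    refine SimpleGraph.Subgraph.ext ?_ ?_
    · rw [Set.eq_univ_of_forall hN.2, Set.eq_univ_of_forall hM.2]
    · funext v w
      exact propext ((hNg v w).trans (hMf v w).symm)

/-- Removing a leaf with its neighbour does not change the number of perfect matchings. -/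
theorem existsUnique_isMatchingMap_erase [DecidableEq V] {G : SimpleGraph V} {S : Finset V} {u v : V}
    (hv : v ∈ S) (h : nbrsIn G S v = {u}) :
    (∃! f, IsMatchingMap G ((S.erase v).erase u) f) ↔ ∃! f, IsMatchingMap G S f := by
  have huS : u ∈ S ∧ G.Adj v u := mem_nbrsIn.1 (h ▸ Finset.mem_singleton_self u)
  have hvu : v ≠ u := huS.2.ne
  -- As `u` is the only neighbour of `v` in `S`, every matching map swaps the two. Turning them into
  -- fixed points (`down`) and swapping them again (`up`) are mutually inverse.
  have down : ∀ f, IsMatchingMap G S f → f v = u ∧ f u = v ∧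
      IsMatchingMap G ((S.erase v).erase u) (Function.update (Function.update f u u) v v) := by
    intro f hf
    have h1 : f v = u := by
      have : f v ∈ nbrsIn G S v := mem_nbrsIn.2 ⟨hf.mem v hv, hf.adj v hv⟩
      simpa [h] using this
    have h2 : f u = v := h1 ▸ hf.invol v hv
    refine ⟨h1, h2, ⟨?_, ?_, ?_, ?_⟩⟩
    · intro x hx
      simp only [Finset.mem_erase] at hx ⊢
      obtain ⟨hxu, hxv, hxS⟩ := hx
      rw [Function.update_of_ne hxv, Function.update_of_ne hxu]
      refine ⟨fun e => hxv ?_, fun e => hxu ?_, hf.mem x hxS⟩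
      · rw [← hf.invol x hxS, e, h2]
      · rw [← hf.invol x hxS, e, h1]
    · intro x hx
      simp only [Finset.mem_erase] at hx
      obtain ⟨hxu, hxv, hxS⟩ := hx
      rw [Function.update_of_ne hxv, Function.update_of_ne hxu]
      exact hf.adj x hxS
    · intro x hx
      simp only [Finset.mem_erase] at hx
      obtain ⟨hxu, hxv, hxS⟩ := hx
      rw [Function.update_of_ne hxv, Function.update_of_ne hxu]
      rw [Function.update_of_ne, Function.update_of_ne, hf.invol x hxS]
      · intro e
        apply hxv
        rw [← hf.invol x hxS, e, h2]
      · intro e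
        apply hxu
        rw [← hf.invol x hxS, e, h1]
    · intro x hx
      by_cases hxv : x = v
      · subst hxv; simp
      by_cases hxu : x = u
      · subst hxu; rw [Function.update_of_ne hxv]; simp
      rw [Function.update_of_ne hxv, Function.update_of_ne hxu]
      exact hf.fixed x fun hxS => hx (by simp [hxu, hxv, hxS])
  have up : ∀ f, IsMatchingMap G ((S.erase v).erase u) f →
      IsMatchingMap G S (Function.update (Function.update f u v) v u) := by
    intro f hf
    have cases : ∀ x ∈ S, x = v ∨ x = u ∨ x ≠ v ∧ x ≠ u ∧ x ∈ (S.erase v).erase u := by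
      intro x hx
      by_cases hxv : x = v
      · exact Or.inl hxv
      by_cases hxu : x = u
      · exact Or.inr (Or.inl hxu)
      exact Or.inr (Or.inr ⟨hxv, hxu, by simp [hxu, hxv, hx]⟩)
    have ne : ∀ x ∈ (S.erase v).erase u, f x ≠ v ∧ f x ≠ u ∧ f x ∈ S := by
      intro x hx
      have := hf.mem x hx
      simp only [Finset.mem_erase] at this
      exact ⟨this.2.1, this.1, this.2.2⟩
    refine ⟨fun x hx => ?_, fun x hx => ?_, fun x hx => ?_, fun x hx => ?_⟩
    · rcases cases x hx with rfl | rfl | ⟨hxv, hxu, hx'⟩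
      · simpa using huS.1
      · simpa [Function.update_of_ne hvu.symm] using hv
      · rw [Function.update_of_ne hxv, Function.update_of_ne hxu]
        exact (ne x hx').2.2
    · rcases cases x hx with rfl | rfl | ⟨hxv, hxu, hx'⟩
      · simpa using huS.2
      · simpa [Function.update_of_ne hvu.symm] using huS.2.symm
      · rw [Function.update_of_ne hxv, Function.update_of_ne hxu]
        exact hf.adj x hx'
    · rcases cases x hx with rfl | rfl | ⟨hxv, hxu, hx'⟩
      · simp [Function.update_of_ne hvu.symm]
      · simp [Function.update_of_ne hvu.symm]
      · rw [Function.update_of_ne hxv, Function.update_of_ne hxu,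
          Function.update_of_ne (ne x hx').1, Function.update_of_ne (ne x hx').2.1]
        exact hf.invol x hx'
    · rw [Function.update_of_ne (fun e => hx (by rwa [e])),
        Function.update_of_ne (fun e => hx (by rw [e]; exact huS.1))]
      exact hf.fixed x (by simp [hx])
  constructor
  · rintro ⟨f, hf, hu⟩
    refine ⟨_, up f hf, fun g hg => ?_⟩
    obtain ⟨h1, h2, h3⟩ := down g hg
    rw [← hu _ h3]
    funext x
    by_cases hxv : x = v
    · subst hxv; simp [h1]
    by_cases hxu : x = u
    · subst hxu; simp [h2, Function.update_of_ne hvu.symm]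
    simp [hxv, hxu]
  · rintro ⟨f, hf, hu⟩
    refine ⟨_, (down f hf).2.2, fun g hg => ?_⟩
    rw [← hu _ (up g hg)]
    funext x
    by_cases hxv : x = v
    · subst hxv; simp [hg.fixed x (by simp)]
    by_cases hxu : x = u
    · subst hxu; simp [Function.update_of_ne hvu.symm, hg.fixed x (by simp)]
    simp [hxv, hxu]

/-- The clause `fixed` leaves only the identity; without it, values outside the set would spoil
uniqueness. -/
theorem existsUnique_isMatchingMap_empty (G : SimpleGraph V) :
    ∃! f, IsMatchingMap G ∅ f :=
  ⟨id, ⟨by simp, by simp, by simp, by simp⟩, fun f hf => funext fun v => hf.fixed v (by simp)⟩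

/-- A unicyclic graph becomes acyclic by deleting a suitable edge. -/
theorem IsUnicyclic.exists_isAcyclic_deleteEdges {G : SimpleGraph V} (hG : IsUnicyclic G) :
    ∃ a b : V, (G.deleteEdges {s(a, b)}).IsAcyclic := by
  obtain ⟨H, ⟨v, p, hp, rfl⟩, hu⟩ := hG
  refine ⟨v, p.snd, ?_⟩
  intro w q hq
  have hle := G.deleteEdges_le {s(v, p.snd)}
  -- A cycle that survives the deletion is a cycle of `G`, so it has the same edges as `p`,
  -- including the deleted first edge of `p`.
  have h1 := hu _ ⟨w, q.mapLe hle, hq.mapLe hle, rfl⟩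
  have h2 : p.toSubgraph.Adj v p.snd := p.toSubgraph_adj_snd hp.not_nil
  rw [← h1, SimpleGraph.Walk.adj_toSubgraph_mapLe] at h2
  simpa using h2.adj_sub

/-- The forest extends to a spanning tree of the complete graph. -/
theorem card_edgeFinset_lt_of_isAcyclic [Fintype V] [Nonempty V] {F : SimpleGraph V} [Fintype F.edgeSet]
    (hF : F.IsAcyclic) : F.edgeFinset.card < Fintype.card V := by
  classical
  obtain ⟨T, hFT, -, hT⟩ := (SimpleGraph.connected_top (V := V)).exists_isTree_le_of_le_of_isAcyclic
    le_top hF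
  have := hT.card_edgeFinset
  have := Finset.card_le_card (SimpleGraph.edgeFinset_mono hFT)
  omega

/-- Handshaking in the induced forest. The slack of 2 makes room for one additional edge. -/
theorem sum_card_nbrsIn_of_isAcyclic {F : SimpleGraph V} (hF : F.IsAcyclic)
    {S : Finset V} (hS : S.Nonempty) : ∑ v ∈ S, (nbrsIn F S v).card + 2 ≤ 2 * S.card := by
  classical
  have : Nonempty (S : Set V) := hS.to_subtype
  have h1 := card_edgeFinset_lt_of_isAcyclic (hF.induce (S : Set V))
  have h2 := (F.induce (S : Set V)).sum_degrees_eq_twice_card_edges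
  have h3 : ∑ v ∈ S, (nbrsIn F S v).card = ∑ v : (S : Set V), (F.induce (S : Set V)).degree v := by
    rw [← Finset.sum_coe_sort S]
    refine Finset.sum_congr rfl fun v _ => ?_
    rw [← SimpleGraph.card_neighborFinset_eq_degree,
      ← Finset.card_map (Function.Embedding.subtype _)]
    congr 1
    ext w
    simp [mem_nbrsIn, and_comm]
  have h4 : Fintype.card (S : Set V) = S.card := by simp
  omega

/-- Restoring the deleted edge `ab` raises only the degrees of `a` and `b`, each by at most one,
which uses up the slack of the forest bound. -/
theorem IsUnicyclic.sum_card_nbrsIn_le {G : SimpleGraph V} (hG : IsUnicyclic G)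
    {S : Finset V} (hS : S.Nonempty) : ∑ v ∈ S, (nbrsIn G S v).card ≤ 2 * S.card := by
  classical
  obtain ⟨a, b, hF⟩ := hG.exists_isAcyclic_deleteEdges
  have h := sum_card_nbrsIn_of_isAcyclic hF hS
  have h1 : ∀ v ∈ S, (nbrsIn G S v).card ≤ (nbrsIn (G.deleteEdges {s(a, b)}) S v).card +
      ((if v = a then 1 else 0) + (if v = b then 1 else 0)) := by
    intro v _
    have hsub : nbrsIn G S v ⊆ nbrsIn (G.deleteEdges {s(a, b)}) S v ∪
        ((if v = a then {b} else ∅) ∪ (if v = b then {a} else ∅)) := by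
      intro w hw
      simp only [Finset.mem_union, mem_nbrsIn, SimpleGraph.deleteEdges_adj] at hw ⊢
      by_cases e : s(v, w) = s(a, b)
      · right
        rcases Sym2.eq_iff.1 e with ⟨rfl, rfl⟩ | ⟨rfl, rfl⟩ <;> simp
      · exact Or.inl ⟨hw.1, hw.2, e⟩
    refine (Finset.card_le_card hsub).trans ((Finset.card_union_le _ _).trans ?_)
    refine Nat.add_le_add_left ((Finset.card_union_le _ _).trans (Nat.add_le_add ?_ ?_)) _ <;>
      split_ifs <;> simp
  have h2 := Finset.sum_le_sum h1
  rw [Finset.sum_add_distrib, Finset.sum_add_distrib, Finset.sum_ite_eq', Finset.sum_ite_eq'] at h2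
  have h3 : (if a ∈ S then 1 else 0) ≤ 1 := by split_ifs <;> simp
  have h4 : (if b ∈ S then 1 else 0) ≤ 1 := by split_ifs <;> simp
  omega

/-- If leaves are lacking, then a perfect matching of the subgraph induced by a nonempty set
is not unique: that subgraph is regular of degree two, and the complement of a perfect matching
is a perfect matching, too. -/
theorem IsUnicyclic.not_existsUnique_isMatchingMap {G : SimpleGraph V} (hG : IsUnicyclic G)
    {S : Finset V} (hS : S.Nonempty) (h : ∀ v ∈ S, (nbrsIn G S v).card ≠ 1) :
    ¬ ∃! f, IsMatchingMap G S f := by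
  classical
  rintro ⟨f, hf, hu⟩
  have hmem : ∀ v ∈ S, f v ∈ nbrsIn G S v := fun v hv => mem_nbrsIn.2 ⟨hf.mem v hv, hf.adj v hv⟩
  have hge : ∀ v ∈ S, 2 ≤ (nbrsIn G S v).card := by
    intro v hv
    have := Finset.card_pos.2 ⟨_, hmem v hv⟩
    have := h v hv
    omega
  -- Termwise lower bounds whose sum is attained are equalities.
  have heq : ∀ v ∈ S, 2 = (nbrsIn G S v).card := by
    refine (Finset.sum_eq_sum_iff_of_le hge).1 (le_antisymm (Finset.sum_le_sum hge) ?_)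
    have := hG.sum_card_nbrsIn_le hS
    simp only [Finset.sum_const, smul_eq_mul]
    omega
  have hother : ∀ v, ∃ w, v ∈ S → (nbrsIn G S v).erase (f v) = {w} := by
    intro v
    by_cases hv : v ∈ S
    · have : ((nbrsIn G S v).erase (f v)).card = 1 := by
        rw [Finset.card_erase_of_mem (hmem v hv), ← heq v hv]
      obtain ⟨w, hw⟩ := Finset.card_eq_one.1 this
      exact ⟨w, fun _ => hw⟩
    · exact ⟨v, fun hv' => absurd hv' hv⟩
  choose g hg using hother
  have hg1 : ∀ v ∈ S, g v ≠ f v ∧ g v ∈ S ∧ G.Adj v (g v) := by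
    intro v hv
    have : g v ∈ (nbrsIn G S v).erase (f v) := by rw [hg v hv]; simp
    rwa [Finset.mem_erase, mem_nbrsIn] at this
  have hg2 : ∀ v ∈ S, ∀ w ∈ S, G.Adj v w → w ≠ f v → g v = w := by
    intro v hv w hw hvw hne
    have : w ∈ (nbrsIn G S v).erase (f v) := by
      rw [Finset.mem_erase, mem_nbrsIn]; exact ⟨hne, hw, hvw⟩
    rw [hg v hv, Finset.mem_singleton] at this
    exact this.symm
  have hM : IsMatchingMap G S fun v => if v ∈ S then g v else v := by
    refine ⟨fun v hv => ?_, fun v hv => ?_, fun v hv => ?_, fun v hv => ?_⟩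
    · simpa [hv] using (hg1 v hv).2.1
    · simpa [hv] using (hg1 v hv).2.2
    · obtain ⟨h1, h2, h3⟩ := hg1 v hv
      simp only [hv, if_true, h2]
      -- The edge from `v` to `g v` is unmatched at its other end, too: `v = f (g v)` would give `f
      -- v = g v`.
      refine hg2 _ h2 v hv h3.symm fun e => h1 ?_
      have h4 := hf.invol _ h2
      rw [← e] at h4
      exact h4.symm
    · simp [hv]
  obtain ⟨v, hv⟩ := hS
  have := congrFun (hu _ hM) v
  simp only [hv, if_true] at this
  exact (hg1 v hv).1 this

end Matchings

/-! ### Total-correctness rules with running times. -/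

section Machine

/-- Started in `s`, the program `p` halts, and its running time and final memory satisfy `Q`. -/
def Runs (p : Prog) (s : Memory) (Q : ℕ → Memory → Prop) : Prop :=
  ∃ t s', Exec p s t s' ∧ Q t s'

theorem Runs.mono {p : Prog} {s : Memory} {Q R : ℕ → Memory → Prop} (h : Runs p s Q)
    (hQR : ∀ t s', Q t s' → R t s') : Runs p s R :=
  let ⟨t, s', he, hq⟩ := h
  ⟨t, s', he, hQR t s' hq⟩

variable {s : Memory} {Q : ℕ → Memory → Prop}

/-- This rule and the following ones are read backwards: applying them executes a program
symbolically and leaves the postcondition for the updated memory. -/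
theorem runs_skip (h : Q 1 s) : Runs .skip s Q :=
  ⟨_, _, .skip s, h⟩

theorem runs_const {x : Reg} {c : ℕ} (h : Q 1 (s.setReg x c)) : Runs (.const x c) s Q :=
  ⟨_, _, .const s x c, h⟩

theorem runs_add {x y z : Reg} (h : Q 1 (s.setReg x (s.reg y + s.reg z))) :
    Runs (.add x y z) s Q :=
  ⟨_, _, .add s x y z, h⟩

theorem runs_sub {x y z : Reg} (h : Q 1 (s.setReg x (s.reg y - s.reg z))) :
    Runs (.sub x y z) s Q :=
  ⟨_, _, .sub s x y z, h⟩

theorem runs_load {x y : Reg} {A : Arr} (h : Q 1 (s.setReg x (s.arr A (s.reg y)))) :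
    Runs (.load x A y) s Q :=
  ⟨_, _, .load s x A y, h⟩

theorem runs_store {x y : Reg} {A : Arr} (h : Q 1 (s.setArr A (s.reg x) (s.reg y))) :
    Runs (.store A x y) s Q :=
  ⟨_, _, .store s A x y, h⟩

theorem runs_seq {p q : Prog}
    (h : Runs p s fun t₁ s₁ => Runs q s₁ fun t₂ s₂ => Q (t₁ + t₂) s₂) : Runs (.seq p q) s Q :=
  let ⟨_, _, h₁, _, _, h₂, hq⟩ := h
  ⟨_, _, .seq h₁ h₂, hq⟩

theorem runs_branch {g : Guard} {p q : Prog}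
    (h₁ : g.Holds s → Runs p s fun t => Q (1 + t))
    (h₂ : ¬ g.Holds s → Runs q s fun t => Q (1 + t)) : Runs (.branch g p q) s Q := by
  by_cases hg : g.Holds s
  · obtain ⟨t, s', h, hq⟩ := h₁ hg
    exact ⟨_, _, .branch_true hg h, hq⟩
  · obtain ⟨t, s', h, hq⟩ := h₂ hg
    exact ⟨_, _, .branch_false hg h, hq⟩

/-- A loop halts if it has an invariant `I m s` whose potential `m` pays for the steps. -/
theorem runs_loop {g : Guard} {p : Prog} (I : ℕ → Memory → Prop) {m : ℕ}
    (h : ∀ m s, I m s → g.Holds s → Runs p s fun t s' => ∃ m', I m' s' ∧ 1 + t + m' ≤ m)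
    (hs : I m s) :
    Runs (.loop g p) s fun t s' => ∃ m', I m' s' ∧ ¬ g.Holds s' ∧ t + m' ≤ m + 1 := by
  -- The potential strictly decreases, because each round pays at least for its test. The extra step
  -- in the bound is the final, failing test.
  induction m using Nat.strong_induction_on generalizing s with
  | _ m ih =>
    by_cases hg : g.Holds s
    · obtain ⟨t₁, s₁, h₁, m₁, hI, hm⟩ := h m s hs hg
      obtain ⟨t₂, s₂, h₂, m₂, hI', hg', hm'⟩ := ih m₁ (by omega) hI
      exact ⟨_, _, .loop_true hg h₁ h₂, m₂, hI', hg', by omega⟩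
    · exact ⟨_, _, .loop_false hg, m, hs, hg, by omega⟩

/-- Consequence rule for `runs_loop`. -/
theorem runs_loop_of {g : Guard} {p : Prog} (I : ℕ → Memory → Prop) {m : ℕ} (hs : I m s)
    (h : ∀ m s, I m s → g.Holds s → Runs p s fun t s' => ∃ m', I m' s' ∧ 1 + t + m' ≤ m)
    (hQ : ∀ t m' s', I m' s' → ¬ g.Holds s' → t + m' ≤ m + 1 → Q t s') :
    Runs (.loop g p) s Q :=
  (runs_loop I h hs).mono fun t s' ⟨m', h₁, h₂, h₃⟩ => hQ t m' s' h₁ h₂ h₃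

@[simp] theorem setReg_reg (s : Memory) (x y : Reg) (c : ℕ) :
    (s.setReg x c).reg y = if y = x then c else s.reg y := by
  simp [Memory.setReg, Function.update_apply]

@[simp] theorem setReg_arr (s : Memory) (x : Reg) (c : ℕ) : (s.setReg x c).arr = s.arr := rfl

@[simp] theorem setArr_reg (s : Memory) (A : Arr) (p c : ℕ) : (s.setArr A p c).reg = s.reg := rfl

@[simp] theorem setArr_arr (s : Memory) (A B : Arr) (p c : ℕ) :
    (s.setArr A p c).arr B = if B = A then Function.update (s.arr A) p c else s.arr B := by
  by_cases h : B = A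
  · subst h; simp [Memory.setArr]
  · simp [Memory.setArr, h]

end Machine

/-! ### Input representation, initialization and final test. -/

section Algorithm

variable {n : ℕ} {G : SimpleGraph (Fin n)}

theorem IsInput.congr {s s' : Memory} (h : IsInput G s) (h1 : s'.reg .size = s.reg .size)
    (h2 : s'.arr .off = s.arr .off) (h3 : s'.arr .nbr = s.arr .nbr) : IsInput G s' := by
  constructor
  · rw [h1]; exact h.size_eq
  · rw [h2]; exact h.off_zero
  · rw [h2]; exact h.off_le
  · rw [h2, h3]; exact h.nbr_bijOn

/-- The number of cells of the adjacency list of `v`. -/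
noncomputable def listLength (G : SimpleGraph (Fin n)) (v : Fin n) : ℕ := (G.neighborSet v).ncard

theorem IsInput.sub_eq {s : Memory} (h : IsInput G s) (v : Fin n) :
    s.arr .off (v + 1) - s.arr .off v = listLength G v := by
  have h1 := (h.nbr_bijOn v).image_eq ▸ (h.nbr_bijOn v).injOn.ncard_image
  rw [Set.ncard_image_of_injective _ Fin.val_injective] at h1
  rw [listLength, h1, ← Nat.card_Ico, ← Set.ncard_coe_finset, Finset.coe_Ico]

theorem IsInput.exists_nbr_eq {s : Memory} (h : IsInput G s) {v : Fin n} {p : ℕ}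
    (h1 : s.arr .off v ≤ p) (h2 : p < s.arr .off (v + 1)) :
    ∃ w : Fin n, s.arr .nbr p = w ∧ G.Adj v w := by
  obtain ⟨w, hw, he⟩ := (h.nbr_bijOn v).mapsTo ⟨h1, h2⟩
  exact ⟨w, he.symm, hw⟩

theorem IsInput.exists_index {s : Memory} (h : IsInput G s) {v w : Fin n} (hvw : G.Adj v w) :
    ∃ p, s.arr .off v ≤ p ∧ p < s.arr .off (v + 1) ∧ s.arr .nbr p = w := by
  obtain ⟨p, ⟨h1, h2⟩, he⟩ := (h.nbr_bijOn v).surjOn ⟨w, hvw, rfl⟩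
  exact ⟨p, h1, h2, he⟩

/-- The memory holds the graph and the constants. -/
structure Ready (G : SimpleGraph (Fin n)) (s : Memory) : Prop where
  input : IsInput G s
  zero : s.reg .zero = 0
  one : s.reg .one = 1

theorem Ready.congr {s s' : Memory} (h : Ready G s) (h1 : s'.reg .size = s.reg .size)
    (h2 : s'.reg .zero = s.reg .zero) (h3 : s'.reg .one = s.reg .one)
    (h4 : s'.arr .off = s.arr .off) (h5 : s'.arr .nbr = s.arr .nbr) : Ready G s' :=
  ⟨h.input.congr h1 h4 h5, h2.trans h.zero, h3.trans h.one⟩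

/-- The array `alive` describes the set `S`. -/
def AliveIs (S : Finset (Fin n)) (s : Memory) : Prop :=
  ∀ v : Fin n, s.arr .alive v = if v ∈ S then 1 else 0

/-- The queue contains vertices only, and it contains all vertices of `L`. -/
structure Queued (L : Fin n → Prop) (s : Memory) : Prop where
  head_le : s.reg .head ≤ s.reg .tail
  lt : ∀ p, s.reg .head ≤ p → p < s.reg .tail → s.arr .queue p < n
  mem : ∀ v, L v → ∃ p, s.reg .head ≤ p ∧ p < s.reg .tail ∧ s.arr .queue p = v

/-- The situation after `initVertices`. -/
structure Initialized (G : SimpleGraph (Fin n)) (s : Memory) : Prop where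
  ready : Ready G s
  alive : ∀ v : Fin n, s.arr .alive v = 1
  deg : ∀ v : Fin n, s.arr .deg v = listLength G v

theorem runs_initVertices {s : Memory} (hs : Ready G s) :
    Runs initVertices s fun t s' => Initialized G s' ∧ t ≤ 8 * n + 2 := by
  apply runs_seq; apply runs_const
  -- Each round costs 8 steps: the test and seven instructions.
  refine runs_loop_of (fun m s => Ready G s ∧ s.reg .i ≤ n ∧ m = 8 * (n - s.reg .i) ∧
    ∀ v : Fin n, v < s.reg .i → s.arr .alive v = 1 ∧ s.arr .deg v = listLength G v)
    (m := 8 * n) ⟨?_, ?_, ?_, ?_⟩ ?_ ?_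
  · exact hs.congr (by simp) (by simp) (by simp) (by simp) (by simp)
  · simp
  · simp
  · simp
  · rintro m s ⟨hr, hi, rfl, hv⟩ hg
    have hin : s.reg .i < n := by simpa [Guard.Holds, hr.input.size_eq] using hg
    apply runs_seq; apply runs_store
    apply runs_seq; apply runs_load
    apply runs_seq; apply runs_add
    apply runs_seq; apply runs_load
    apply runs_seq; apply runs_sub
    apply runs_seq; apply runs_store
    apply runs_add
    refine ⟨8 * (n - (s.reg .i + 1)), ⟨?_, ?_, ?_, ?_⟩, ?_⟩
    · exact hr.congr (by simp) (by simp) (by simp) (by simp) (by simp)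
    · simp [hr.one]; omega
    · simp [hr.one]
    · intro v hlt
      simp only [setReg_reg, setReg_arr, setArr_arr, setArr_reg, reduceCtorEq, if_true, if_false,
        hr.one] at hlt ⊢
      by_cases e : (v : ℕ) = s.reg .i
      · rw [← e]; simp [← hr.input.sub_eq]
      · simpa [Function.update_of_ne e] using hv v (by omega)
    · omega
  · rintro t m s ⟨hr, hi, rfl, hv⟩ hg ht
    have hin : s.reg .i = n := le_antisymm hi (by simpa [Guard.Holds, hr.input.size_eq] using hg)
    exact ⟨⟨hr, fun v => (hv v (by omega)).1, fun v => (hv v (by omega)).2⟩, by omega⟩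

theorem runs_initQueue {s : Memory} (hs : Initialized G s) :
    Runs initQueue s fun t s' => Initialized G s' ∧ Queued (fun v => listLength G v = 1) s' ∧
      s'.reg .tail ≤ n ∧ t ≤ 6 * n + 4 := by
  apply runs_seq; apply runs_const
  apply runs_seq; apply runs_const
  apply runs_seq; apply runs_const
  -- A round costs at most 6 steps. At most one vertex is appended per round, whence `tail ≤ i`;
  -- this bounds the initial queue by `n`.
  refine runs_loop_of (fun m s => Initialized G s ∧ s.reg .i ≤ n ∧ m = 6 * (n - s.reg .i) ∧
    s.reg .tail ≤ s.reg .i ∧ s.reg .head = 0 ∧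
    Queued (fun v => listLength G v = 1 ∧ (v : ℕ) < s.reg .i) s)
    (m := 6 * n) ⟨⟨?_, ?_, ?_⟩, ?_, ?_, ?_, ?_, ?_, ?_, ?_⟩ ?_ ?_
  · exact hs.ready.congr (by simp) (by simp) (by simp) (by simp) (by simp)
  · simpa using hs.alive
  · simpa using hs.deg
  · simp
  · simp
  · simp
  · simp
  · simp
  · simp
  · simp
  · rintro m s ⟨hI, hi, rfl, htl, hhd, hq⟩ hg
    have hr := hI.ready
    have hin : s.reg .i < n := by simpa [Guard.Holds, hr.input.size_eq] using hg
    have hdeg := hI.deg ⟨_, hin⟩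
    apply runs_seq; apply runs_load
    apply runs_seq; apply runs_branch <;> intro hb <;>
      simp only [Guard.Holds, setReg_reg, reduceCtorEq, if_true, if_false,
        hr.one] at hb
    · apply runs_seq; apply runs_store; apply runs_add
      apply runs_add
      refine ⟨6 * (n - (s.reg .i + 1)), ⟨⟨?_, ?_, ?_⟩, ?_, ?_, ?_, ?_, ?_, ?_, ?_⟩, ?_⟩
      · exact hr.congr (by simp) (by simp) (by simp) (by simp) (by simp)
      · simpa using hI.alive
      · simpa using hI.deg
      · simp [hr.one]; omega
      · simp [hr.one]
      · simp [hr.one]; omega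
      · simp [hhd]
      · simp [hhd]
      · intro p hp1 hp2
        simp [hr.one] at hp1 hp2 ⊢
        by_cases e : p = s.reg .tail
        · subst e; simpa using hin
        · rw [Function.update_of_ne e]; exact hq.lt p hp1 (by omega)
      · rintro v ⟨hv, hvi⟩
        simp [hr.one] at hvi ⊢
        by_cases e : (v : ℕ) = s.reg .i
        · exact ⟨s.reg .tail, hq.head_le, by omega, by simp [e]⟩
        · obtain ⟨p, h1, h2, h3⟩ := hq.mem v ⟨hv, by omega⟩
          exact ⟨p, h1, by omega, by rw [Function.update_of_ne (by omega), h3]⟩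
      · omega
    · apply runs_skip
      apply runs_add
      refine ⟨6 * (n - (s.reg .i + 1)), ⟨⟨?_, ?_, ?_⟩, ?_, ?_, ?_, ?_, ?_, ?_, ?_⟩, ?_⟩
      · exact hr.congr (by simp) (by simp) (by simp) (by simp) (by simp)
      · simpa using hI.alive
      · simpa using hI.deg
      · simp [hr.one]; omega
      · simp [hr.one]
      · simp [hr.one]; omega
      · simp [hhd]
      · simp [hhd]
      · simpa using hq.lt
      · rintro v ⟨hv, hvi⟩
        simp [hr.one] at hvi ⊢
        by_cases e : (v : ℕ) = s.reg .i
        · rw [← e, hI.deg v] at hb; exact absurd hv hb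
        · exact hq.mem v ⟨hv, by omega⟩
      · omega
  · rintro t m s ⟨hI, hi, rfl, htl, hhd, hq⟩ hg ht
    have hin : s.reg .i = n :=
      le_antisymm hi (by simpa [Guard.Holds, hI.ready.input.size_eq] using hg)
    exact ⟨hI, ⟨hq.head_le, hq.lt, fun v hv => hq.mem v ⟨hv, by omega⟩⟩, by omega, by omega⟩

theorem runs_testEmpty {S : Finset (Fin n)} {s : Memory} (hs : Ready G s) (hS : AliveIs S s) :
    Runs testEmpty s fun t s' => (s'.reg .ans = 1 ∧ S = ∅ ∨ s'.reg .ans = 0 ∧ S.Nonempty) ∧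
      t ≤ 5 * n + 3 := by
  apply runs_seq; apply runs_const
  apply runs_seq; apply runs_const
  refine runs_loop_of (fun m s => Ready G s ∧ AliveIs S s ∧ s.reg .i ≤ n ∧
    m = 5 * (n - s.reg .i) ∧
    (s.reg .ans = 1 ∧ (∀ v : Fin n, v < s.reg .i → v ∉ S) ∨ s.reg .ans = 0 ∧ S.Nonempty))
    (m := 5 * n) ⟨?_, ?_, ?_, ?_, ?_⟩ ?_ ?_
  · exact hs.congr (by simp) (by simp) (by simp) (by simp) (by simp)
  · simpa [AliveIs] using hS
  · simp
  · simp
  · simp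
  · rintro m s ⟨hr, hS, hi, rfl, ha⟩ hg
    have hin : s.reg .i < n := by simpa [Guard.Holds, hr.input.size_eq] using hg
    have hal := hS ⟨_, hin⟩
    simp only at hal
    apply runs_seq; apply runs_load
    apply runs_seq; apply runs_branch <;> intro hb <;>
      simp only [Guard.Holds, setReg_reg, reduceCtorEq, if_true, if_false,
        hr.one, hal] at hb
    · apply runs_const
      apply runs_add
      refine ⟨5 * (n - (s.reg .i + 1)), ⟨?_, ?_, ?_, ?_, ?_⟩, ?_⟩
      · exact hr.congr (by simp) (by simp) (by simp) (by simp) (by simp)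
      · simpa [AliveIs] using hS
      · simp [hr.one]; omega
      · simp [hr.one]
      · exact Or.inr ⟨by simp, ⟨s.reg .i, hin⟩, by by_contra h; simp [h] at hb⟩
      · omega
    · apply runs_skip
      apply runs_add
      refine ⟨5 * (n - (s.reg .i + 1)), ⟨?_, ?_, ?_, ?_, ?_⟩, ?_⟩
      · exact hr.congr (by simp) (by simp) (by simp) (by simp) (by simp)
      · simpa [AliveIs] using hS
      · simp [hr.one]; omega
      · simp [hr.one]
      · refine ha.imp (fun h => ⟨by simpa using h.1, fun v hv => ?_⟩)
          fun h => ⟨by simpa using h.1, h.2⟩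
        simp [hr.one] at hv
        by_cases e : (v : ℕ) = s.reg .i
        · obtain rfl : v = ⟨_, hin⟩ := Fin.ext e
          exact fun h => hb (if_pos h)
        · exact h.2 v (by omega)
      · omega
  · rintro t m s ⟨hr, hS, hi, rfl, ha⟩ hg ht
    have hin : s.reg .i = n := le_antisymm hi (by simpa [Guard.Holds, hr.input.size_eq] using hg)
    refine ⟨ha.imp (fun h => ⟨h.1, ?_⟩) id, by omega⟩
    exact Finset.eq_empty_of_forall_notMem fun v => h.2 v (by omega)

end Algorithm

/-! ### The main loop and its amortized cost. -/

section MainLoop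

variable {n : ℕ} {G : SimpleGraph (Fin n)}

/-- The situation in the main loop, if the current graph is induced by `S`. -/
structure Running (G : SimpleGraph (Fin n)) (S : Finset (Fin n)) (s : Memory) : Prop where
  ready : Ready G s
  alive : AliveIs S s
  deg : ∀ v ∈ S, s.arr .deg v = (nbrsIn G S v).card
  queued : Queued (fun v => v ∈ S ∧ (nbrsIn G S v).card = 1) s

theorem runs_findNeighbour {S : Finset (Fin n)} {s : Memory} {u v : Fin n} (hr : Ready G s)
    (hS : AliveIs S s) (hv : s.reg .v = v) (hu : nbrsIn G S v = {u}) :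
    Runs findNeighbour s fun t s' => s'.arr = s.arr ∧ s'.reg .u = u ∧
      (∀ r, r ≠ .k → r ≠ .u → r ≠ .a → s'.reg r = s.reg r) ∧ t ≤ 4 * listLength G v + 4 := by
  have huS : u ∈ S ∧ G.Adj v u := mem_nbrsIn.1 (hu ▸ Finset.mem_singleton_self u)
  have hlen := hr.input.sub_eq v
  apply runs_seq; apply runs_load
  apply runs_seq; apply runs_load
  apply runs_seq; apply runs_load
  -- The cell containing `u` is never passed, so the search stays inside the list of `v`.
  refine runs_loop_of (fun m s' => s'.arr = s.arr ∧
    (∀ r, r ≠ .k → r ≠ .u → r ≠ .a → s'.reg r = s.reg r) ∧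
    s'.reg .u = s.arr .nbr (s'.reg .k) ∧ s'.reg .a = s.arr .alive (s'.reg .u) ∧
    s.arr .off v ≤ s'.reg .k ∧
    (∃ p, s'.reg .k ≤ p ∧ p < s.arr .off (v + 1) ∧ s.arr .nbr p = u) ∧
    m = 4 * (s.arr .off (v + 1) - s'.reg .k))
    (m := 4 * listLength G v) ⟨?_, ?_, ?_, ?_, ?_, ?_, ?_⟩ ?_ ?_
  · simp
  · intro r h1 h2 h3; simp [h1, h2, h3]
  · simp
  · simp
  · simp [hv]
  · simpa [hv] using hr.input.exists_index huS.2
  · simp [hv, hlen]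
  · rintro m s' ⟨harr, hreg, hu', ha, hk, ⟨p, hp1, hp2, hp3⟩, rfl⟩ hg
    have hzero : s'.reg .zero = 0 := by rw [hreg _ (by simp) (by simp) (by simp), hr.zero]
    have hone : s'.reg .one = 1 := by rw [hreg _ (by simp) (by simp) (by simp), hr.one]
    simp only [Guard.Holds, hzero, ha, hu'] at hg
    have hne : s'.reg .k ≠ p := by
      rintro rfl
      rw [hp3, hS u, if_pos huS.1] at hg
      exact one_ne_zero hg
    apply runs_seq; apply runs_add
    apply runs_seq; apply runs_load
    apply runs_load
    refine ⟨4 * (s.arr .off (v + 1) - (s'.reg .k + 1)), ⟨?_, ?_, ?_, ?_, ?_, ?_, ?_⟩, ?_⟩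
    · simp [harr]
    · intro r h1 h2 h3; simp [h1, h2, h3, hreg]
    · simp [harr]
    · simp [harr]
    · simp [hone]; omega
    · exact ⟨p, by simp [hone]; omega, hp2, hp3⟩
    · simp [hone]
    · omega
  · rintro t m s' ⟨harr, hreg, hu', ha, hk, ⟨p, hp1, hp2, hp3⟩, rfl⟩ hg ht
    have hzero : s'.reg .zero = 0 := by rw [hreg _ (by simp) (by simp) (by simp), hr.zero]
    obtain ⟨w, hw, hvw⟩ := hr.input.exists_nbr_eq hk (hp1.trans_lt hp2)
    simp only [Guard.Holds, hzero, ha, hu', hw, hS w] at hg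
    have hwS : w ∈ S := by
      by_contra h
      simp [h] at hg
    have hwu : w ∈ nbrsIn G S v := mem_nbrsIn.2 ⟨hwS, hvw⟩
    rw [hu, Finset.mem_singleton] at hwu
    exact ⟨harr, by rw [hu', hw, hwu], hreg, by omega⟩

/-- `w` occurs among the cells `nbr[k], …, nbr[b - 1]`. -/
def Occurs (s : Memory) (k b : ℕ) (w : Fin n) : Prop :=
  ∃ p, k ≤ p ∧ p < b ∧ s.arr .nbr p = w

theorem occurs_iff {s : Memory} {k b : ℕ} {w : Fin n} (h : k < b) :
    Occurs s k b w ↔ s.arr .nbr k = w ∨ Occurs s (k + 1) b w := by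
  constructor
  · rintro ⟨p, h1, h2, h3⟩
    rcases h1.eq_or_lt with rfl | h1
    · exact Or.inl h3
    · exact Or.inr ⟨p, h1, h2, h3⟩
  · rintro (h1 | ⟨p, h1, h2, h3⟩)
    · exact ⟨k, le_rfl, h, h1⟩
    · exact ⟨p, by omega, h2, h3⟩

theorem not_occurs_self {s : Memory} {k b : ℕ} {w : Fin n} (h : b ≤ k) : ¬ Occurs s k b w := by
  rintro ⟨p, h1, h2, -⟩
  omega

theorem IsInput.occurs_iff_adj {s : Memory} (h : IsInput G s) {u w : Fin n} :
    Occurs s (s.arr .off u) (s.arr .off (u + 1)) w ↔ G.Adj u w := by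
  refine ⟨?_, h.exists_index⟩
  rintro ⟨p, h1, h2, h3⟩
  obtain ⟨x, hx, hux⟩ := h.exists_nbr_eq h1 h2
  rwa [Fin.ext (h3.symm.trans hx)]

/-- Lists have no repetitions; this is why no degree is decreased twice in one scan. -/
theorem IsInput.not_occurs_succ {s : Memory} (h : IsInput G s) {u w : Fin n} {k : ℕ}
    (hk : s.arr .off u ≤ k) (hk' : k < s.arr .off (u + 1)) (hw : s.arr .nbr k = w) :
    ¬ Occurs s (k + 1) (s.arr .off (u + 1)) w := by
  rintro ⟨p, h1, h2, h3⟩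
  have := (h.nbr_bijOn u).injOn ⟨hk, hk'⟩ ⟨by omega, h2⟩ (hw.trans h3.symm)
  omega

/-- The situation in the loop of `addNewLeaves`: the degrees of those neighbours of `u`
that are listed from position `k` on are still too large by one. -/
structure Updating (G : SimpleGraph (Fin n)) (S : Finset (Fin n)) (k b : ℕ) (s : Memory) :
    Prop where
  ready : Ready G s
  alive : AliveIs S s
  deg_of_occurs : ∀ w ∈ S, Occurs s k b w → s.arr .deg w = (nbrsIn G S w).card + 1
  deg_of_not_occurs : ∀ w ∈ S, ¬ Occurs s k b w → s.arr .deg w = (nbrsIn G S w).card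
  queued : Queued (fun w => w ∈ S ∧ (nbrsIn G S w).card = 1 ∧ ¬ Occurs s k b w) s

theorem runs_addNewLeaves {S : Finset (Fin n)} {s : Memory} {u : Fin n} (hu : s.reg .u = u)
    (hs : Updating G S (s.arr .off u) (s.arr .off (u + 1)) s) :
    Runs addNewLeaves s fun t s' => Running G S s' ∧ s'.reg .head = s.reg .head ∧
      s'.reg .tail ≤ s.reg .tail + listLength G u ∧ t ≤ 11 * listLength G u + 4 := by
  have hlen := hs.ready.input.sub_eq u
  have hle := hs.ready.input.off_le u
  apply runs_seq; apply runs_load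
  apply runs_seq; apply runs_add
  apply runs_seq; apply runs_load
  -- A round costs at most 11 steps and appends at most one vertex, so `tail` plus the number of
  -- unread cells never grows.
  refine runs_loop_of (fun m s' => Updating G S (s'.reg .k) (s'.reg .b) s' ∧
    s'.reg .b = s'.arr .off (u + 1) ∧ s'.arr .off u ≤ s'.reg .k ∧ s'.reg .k ≤ s'.reg .b ∧
    s'.reg .head = s.reg .head ∧
    s'.reg .tail + (s'.reg .b - s'.reg .k) ≤ s.reg .tail + listLength G u ∧
    m = 11 * (s'.reg .b - s'.reg .k))
    (m := 11 * listLength G u) ⟨⟨?_, ?_, ?_, ?_, ?_, ?_, ?_⟩, ?_, ?_, ?_, ?_, ?_, ?_⟩ ?_ ?_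
  · exact hs.ready.congr (by simp) (by simp) (by simp) (by simp) (by simp)
  · simpa [AliveIs] using hs.alive
  · simpa [Occurs, hu, hs.ready.one] using hs.deg_of_occurs
  · simpa [Occurs, hu, hs.ready.one] using hs.deg_of_not_occurs
  · simpa using hs.queued.head_le
  · simpa using hs.queued.lt
  · simpa [Occurs, hu, hs.ready.one] using hs.queued.mem
  · simp [hu, hs.ready.one]
  · simp [hu]
  · simpa [hu, hs.ready.one] using hle
  · simp
  · simp [hu, hs.ready.one, hlen]
  · simp [hu, hs.ready.one, hlen]
  · rintro m s' ⟨hI, hb, hk, hkb, hhd, htl, rfl⟩ hg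
    have hr := hI.ready
    simp only [Guard.Holds] at hg
    obtain ⟨w, hw, huw⟩ := hr.input.exists_nbr_eq hk (hb ▸ hg)
    have hnot : ¬ Occurs s' (s'.reg .k + 1) (s'.reg .b) w :=
      hb ▸ hr.input.not_occurs_succ hk (hb ▸ hg) hw
    have hocc : Occurs s' (s'.reg .k) (s'.reg .b) w := (occurs_iff hg).2 (Or.inl hw)
    have hother : ∀ x : Fin n, x ≠ w →
        (Occurs s' (s'.reg .k) (s'.reg .b) x ↔ Occurs s' (s'.reg .k + 1) (s'.reg .b) x) := by
      intro x hx
      rw [occurs_iff hg, hw, or_iff_right]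
      exact fun e => hx (Fin.ext e.symm)
    have hq := hI.queued
    apply runs_seq; apply runs_load
    apply runs_seq; apply runs_load
    apply runs_seq; apply runs_branch <;> intro hal <;>
      simp only [Guard.Holds, setReg_reg, setReg_arr, reduceCtorEq, if_true, if_false,
        hr.one, hw, hI.alive w] at hal
    · have hwS : w ∈ S := by
        by_contra h
        simp [h] at hal
      have hd := hI.deg_of_occurs w hwS hocc
      apply runs_seq; apply runs_load
      apply runs_seq; apply runs_sub
      apply runs_seq; apply runs_store
      apply runs_branch <;> intro hdeg <;>
        simp [Guard.Holds, hr.one, hw, hd] at hdeg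
      · apply runs_seq; apply runs_store; apply runs_add
        apply runs_add
        refine ⟨11 * (s'.reg .b - (s'.reg .k + 1)),
          ⟨⟨?_, ?_, ?_, ?_, ?_, ?_, ?_⟩, ?_, ?_, ?_, ?_, ?_, ?_⟩, ?_⟩
        · exact hr.congr (by simp) (by simp) (by simp) (by simp) (by simp)
        · simpa [AliveIs] using hI.alive
        · intro x hx h
          simp [Occurs, hr.one] at h
          have hxw : x ≠ w := by rintro rfl; exact hnot h
          simpa [hw, hr.one, Function.update_of_ne (Fin.val_ne_of_ne hxw)] using
            hI.deg_of_occurs x hx ((hother x hxw).2 h)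
        · intro x hx h
          simp [Occurs, hr.one] at h
          by_cases hxw : x = w
          · subst hxw; simp [hw, hd, hr.one]
          · simpa [hw, hr.one, Function.update_of_ne (Fin.val_ne_of_ne hxw)] using
              hI.deg_of_not_occurs x hx (mt (hother x hxw).1 (by simpa [Occurs] using h))
        · have := hq.head_le
          simp [hr.one]; omega
        · intro p hp1 hp2
          simp [hr.one, hw] at hp1 hp2 ⊢
          by_cases e : p = s'.reg .tail
          · subst e; simp
          · rw [Function.update_of_ne e]; exact hq.lt p hp1 (by omega)
        · rintro x ⟨hx, hx1, h⟩
          simp [Occurs, hr.one] at h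
          simp [hr.one, hw]
          by_cases hxw : x = w
          · exact ⟨s'.reg .tail, hq.head_le, by omega, by simp [hxw]⟩
          · obtain ⟨p, h1, h2, h3⟩ :=
              hq.mem x ⟨hx, hx1, mt (hother x hxw).1 (by simpa [Occurs] using h)⟩
            exact ⟨p, h1, by omega, by rw [Function.update_of_ne (by omega), h3]⟩
        · simpa using hb
        · simp [hr.one]; omega
        · simp [hr.one]; omega
        · simpa using hhd
        · simp [hr.one]; omega
        · simp [hr.one]
        · omega
      · apply runs_skip
        apply runs_add
        refine ⟨11 * (s'.reg .b - (s'.reg .k + 1)),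
          ⟨⟨?_, ?_, ?_, ?_, ?_, ?_, ?_⟩, ?_, ?_, ?_, ?_, ?_, ?_⟩, ?_⟩
        · exact hr.congr (by simp) (by simp) (by simp) (by simp) (by simp)
        · simpa [AliveIs] using hI.alive
        · intro x hx h
          simp [Occurs, hr.one] at h
          have hxw : x ≠ w := by rintro rfl; exact hnot h
          simpa [hw, hr.one, Function.update_of_ne (Fin.val_ne_of_ne hxw)] using
            hI.deg_of_occurs x hx ((hother x hxw).2 h)
        · intro x hx h
          simp [Occurs, hr.one] at h
          by_cases hxw : x = w
          · subst hxw; simp [hw, hd, hr.one]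
          · simpa [hw, hr.one, Function.update_of_ne (Fin.val_ne_of_ne hxw)] using
              hI.deg_of_not_occurs x hx (mt (hother x hxw).1 (by simpa [Occurs] using h))
        · simpa using hq.head_le
        · simpa using hq.lt
        · rintro x ⟨hx, hx1, h⟩
          simp [Occurs, hr.one] at h
          -- The updated degree of `w` is not one, so `w` need not be queued.
          have hxw : x ≠ w := by rintro rfl; exact hdeg hx1
          simpa using hq.mem x ⟨hx, hx1, mt (hother x hxw).1 (by simpa [Occurs] using h)⟩
        · simpa using hb
        · simp [hr.one]; omega
        · simp [hr.one]; omega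
        · simpa using hhd
        · simp [hr.one]; omega
        · simp [hr.one]
        · omega
    · have hwS : w ∉ S := fun h => hal (if_pos h)
      apply runs_skip
      apply runs_add
      refine ⟨11 * (s'.reg .b - (s'.reg .k + 1)),
        ⟨⟨?_, ?_, ?_, ?_, ?_, ?_, ?_⟩, ?_, ?_, ?_, ?_, ?_, ?_⟩, ?_⟩
      · exact hr.congr (by simp) (by simp) (by simp) (by simp) (by simp)
      · simpa [AliveIs] using hI.alive
      · intro x hx h
        simp [Occurs, hr.one] at h
        have hxw : x ≠ w := by rintro rfl; exact hwS hx
        simpa using hI.deg_of_occurs x hx ((hother x hxw).2 h)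
      · intro x hx h
        simp [Occurs, hr.one] at h
        have hxw : x ≠ w := by rintro rfl; exact hwS hx
        simpa using hI.deg_of_not_occurs x hx (mt (hother x hxw).1 (by simpa [Occurs] using h))
      · simpa using hq.head_le
      · simpa using hq.lt
      · rintro x ⟨hx, hx1, h⟩
        simp [Occurs, hr.one] at h
        have hxw : x ≠ w := by rintro rfl; exact hwS hx
        simpa using hq.mem x ⟨hx, hx1, mt (hother x hxw).1 (by simpa [Occurs] using h)⟩
      · simpa using hb
      · simp [hr.one]; omega
      · simp [hr.one]; omega
      · simpa using hhd
      · simp [hr.one]; omega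
      · simp [hr.one]
      · omega
  · rintro t m s' ⟨hI, hb, hk, hkb, hhd, htl, rfl⟩ hg ht
    have hge : s'.reg .b ≤ s'.reg .k := not_lt.1 hg
    refine ⟨⟨hI.ready, hI.alive, fun v hv => hI.deg_of_not_occurs v hv (not_occurs_self hge),
      hI.queued.head_le, hI.queued.lt, fun v hv => ?_⟩, hhd, by omega, by omega⟩
    exact hI.queued.mem v ⟨hv.1, hv.2, not_occurs_self hge⟩

/-- After the removal of a leaf `v` and its neighbour `u`, the degrees of the remaining
neighbours of `u` have to be decreased by one. -/
theorem card_nbrsIn_erase {S : Finset (Fin n)} {u v w : Fin n} (hv : nbrsIn G S v = {u})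
    (hw : w ∈ (S.erase v).erase u) :
    (G.Adj u w → (nbrsIn G S w).card = (nbrsIn G ((S.erase v).erase u) w).card + 1) ∧
      (¬ G.Adj u w → (nbrsIn G S w).card = (nbrsIn G ((S.erase v).erase u) w).card) := by
  simp only [Finset.mem_erase] at hw
  have huS : u ∈ S ∧ G.Adj v u := mem_nbrsIn.1 (hv ▸ Finset.mem_singleton_self u)
  have hvw : ¬ G.Adj w v := by
    intro h
    have : w ∈ nbrsIn G S v := mem_nbrsIn.2 ⟨hw.2.2, h.symm⟩
    rw [hv, Finset.mem_singleton] at this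
    exact hw.1 this
  have heq : nbrsIn G ((S.erase v).erase u) w = (nbrsIn G S w).erase u := by
    ext x
    simp only [mem_nbrsIn, Finset.mem_erase]
    refine ⟨fun h => ⟨h.1.1, h.1.2.2, h.2⟩, fun h => ⟨⟨h.1, ?_, h.2.1⟩, h.2.2⟩⟩
    rintro rfl
    exact hvw h.2.2
  rw [heq]
  constructor
  · intro h
    rw [Finset.card_erase_add_one (mem_nbrsIn.2 ⟨huS.1, h.symm⟩)]
  · intro h
    rw [Finset.erase_eq_of_notMem fun h' => h (mem_nbrsIn.1 h').2.symm]

theorem runs_mainLoop {s : Memory} (hs : Running G Finset.univ s) :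
    Runs mainLoop s fun t s' =>
      (∃ S, Ready G s' ∧ AliveIs S s' ∧ (∀ v ∈ S, (nbrsIn G S v).card ≠ 1) ∧
        ((∃! f, IsMatchingMap G S f) ↔ HasUniquePerfectMatching G)) ∧
      t ≤ 20 * ∑ v, (listLength G v + 1) + 8 * (s.reg .tail - s.reg .head) + 1 := by
  -- A queue entry carries 8, the cost of a round that removes nothing. For a removal, 4 per cell of
  -- `v` covers the search; 11 per cell of `u` covers the update and 8 more a possible new entry,
  -- together 19 ≤ 20. The summands 1 pay for the fixed cost.
  refine runs_loop_of (fun m s => ∃ S, Running G S s ∧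
    ((∃! f, IsMatchingMap G S f) ↔ HasUniquePerfectMatching G) ∧
    m = 20 * ∑ v ∈ S, (listLength G v + 1) + 8 * (s.reg .tail - s.reg .head))
    ⟨Finset.univ, hs, (hasUniquePerfectMatching_iff G).symm, rfl⟩ ?_ ?_
  · rintro m s ⟨S, hI, hS, rfl⟩ hg
    have hr := hI.ready
    have hq := hI.queued
    simp only [Guard.Holds] at hg
    obtain ⟨v, hv⟩ : ∃ v : Fin n, s.arr .queue (s.reg .head) = v :=
      ⟨⟨_, hq.lt _ le_rfl hg⟩, rfl⟩
    apply runs_seq; apply runs_load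
    apply runs_seq; apply runs_add
    apply runs_seq; apply runs_load
    -- Advancing `head` discards only an occurrence of `v`, so any set of leaves without `v` remains
    -- queued.
    have hpop : ∀ (L : Fin n → Prop) (s' : Memory),
        (∀ x, L x → (x ∈ S ∧ (nbrsIn G S x).card = 1) ∧ x ≠ v) →
        s'.reg .head = s.reg .head + 1 → s'.reg .tail = s.reg .tail →
        s'.arr .queue = s.arr .queue → Queued L s' := by
      intro L s' hL h1 h2 h3
      refine ⟨by omega, fun p hp1 hp2 => ?_, fun x hx => ?_⟩
      · rw [h3]; exact hq.lt p (by omega) (by omega)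
      · obtain ⟨hx', hxv⟩ := hL x hx
        obtain ⟨p, hp1, hp2, hp3⟩ := hq.mem x hx'
        have : p ≠ s.reg .head := by
          rintro rfl
          exact hxv (Fin.ext (hp3.symm.trans hv))
        exact ⟨p, by omega, by omega, by rw [h3, hp3]⟩
    apply runs_branch <;> intro hal <;>
      simp only [Guard.Holds, setReg_reg, setReg_arr, reduceCtorEq, if_true, if_false,
        hr.one, hv, hI.alive v] at hal
    · have hvS : v ∈ S := by
        by_contra h
        simp [h] at hal
      have hd := hI.deg v hvS
      apply runs_seq; apply runs_load
      apply runs_branch <;> intro hdeg <;>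
        simp [Guard.Holds, hr.one, hv, hd] at hdeg
      · obtain ⟨u, hu⟩ := Finset.card_eq_one.1 hdeg
        have huS : u ∈ S ∧ G.Adj v u := mem_nbrsIn.1 (hu ▸ Finset.mem_singleton_self u)
        apply runs_seq
        refine (runs_findNeighbour (G := G) (S := S) (u := u) (v := v) ?_ ?_ ?_ hu).mono ?_
        · exact hr.congr (by simp) (by simp) (by simp) (by simp) (by simp)
        · simpa [AliveIs] using hI.alive
        · simpa using hv
        rintro t₁ s₁ ⟨harr, hu₁, hreg, ht₁⟩
        have hreg' : ∀ r, r ≠ .k → r ≠ .u → r ≠ .a → r ≠ .d → r ≠ .v → r ≠ .head →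
            s₁.reg r = s.reg r := by
          intro r h1 h2 h3 h4 h5 h6
          rw [hreg r h1 h2 h3]
          simp [h3, h4, h5, h6]
        have hv₁ : s₁.reg .v = v := by rw [hreg _ (by simp) (by simp) (by simp)]; simpa using hv
        have hhd₁ : s₁.reg .head = s.reg .head + 1 := by
          rw [hreg _ (by simp) (by simp) (by simp)]; simp [hr.one]
        have htl₁ : s₁.reg .tail = s.reg .tail :=
          hreg' _ (by simp) (by simp) (by simp) (by simp) (by simp) (by simp)
        simp only [setReg_arr] at harr
        have hr₁ : Ready G s₁ := hr.congr
          (hreg' _ (by simp) (by simp) (by simp) (by simp) (by simp) (by simp))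
          (hreg' _ (by simp) (by simp) (by simp) (by simp) (by simp) (by simp))
          (hreg' _ (by simp) (by simp) (by simp) (by simp) (by simp) (by simp))
          (by rw [harr]) (by rw [harr])
        apply runs_seq
        apply runs_seq; apply runs_store; apply runs_store
        apply runs_seq
        apply runs_seq; apply runs_store
        apply runs_seq; apply runs_store
        apply runs_add
        have hadj : ∀ (s' : Memory), s'.arr .off = s₁.arr .off → s'.arr .nbr = s₁.arr .nbr →
            ∀ w, Occurs s' (s'.arr .off u) (s'.arr .off (u + 1)) w ↔ G.Adj u w := by
          intro s' h1 h2 w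
          rw [h1, ← hr₁.input.occurs_iff_adj, Occurs, Occurs, h2]
        refine (runs_addNewLeaves (G := G) (S := (S.erase v).erase u) (u := u) ?_
          ⟨?_, ?_, ?_, ?_, ?_⟩).mono ?_
        · simpa using hu₁
        · exact hr₁.congr (by simp) (by simp) (by simp) (by simp) (by simp)
        · intro x
          have := hI.alive x
          simp [hv₁, hu₁, harr, hr₁.zero, Function.update_apply, Fin.val_inj, this]
          grind
        · intro w hw hocc
          rw [hadj _ (by simp) (by simp)] at hocc
          have := hI.deg w (Finset.mem_of_mem_erase (Finset.mem_of_mem_erase hw))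
          simpa [harr, this] using (card_nbrsIn_erase hu hw).1 hocc
        · intro w hw hocc
          rw [hadj _ (by simp) (by simp)] at hocc
          have := hI.deg w (Finset.mem_of_mem_erase (Finset.mem_of_mem_erase hw))
          simpa [harr, this] using (card_nbrsIn_erase hu hw).2 hocc
        · refine hpop _ _ ?_ (by simpa using hhd₁) (by simpa using htl₁) (by simp [harr])
          -- A remaining leaf that is not adjacent to `u` kept its degree, so it was queued before.
          rintro w ⟨hw, hw1, hocc⟩
          rw [hadj _ (by simp) (by simp)] at hocc
          rw [(card_nbrsIn_erase hu hw).2 hocc]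
          simp only [Finset.mem_erase] at hw
          exact ⟨⟨hw.2.2, hw1⟩, hw.2.1⟩
        · rintro t₂ s₂ ⟨hI₂, hhd₂, htl₂, ht₂⟩
          simp [hhd₁, htl₁] at hhd₂ htl₂
          refine ⟨_, ⟨_, hI₂, (existsUnique_isMatchingMap_erase hvS hu).trans hS, rfl⟩, ?_⟩
          have h1 := Finset.add_sum_erase S (fun x => listLength G x + 1) hvS
          have h2 := Finset.add_sum_erase (S.erase v) (fun x => listLength G x + 1)
            (Finset.mem_erase.2 ⟨huS.2.ne', huS.1⟩)
          omega
      · apply runs_skip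
        refine ⟨_, ⟨S, ⟨?_, ?_, ?_, ?_⟩, hS, rfl⟩, ?_⟩
        · exact hr.congr (by simp) (by simp) (by simp) (by simp) (by simp)
        · simpa [AliveIs] using hI.alive
        · simpa using hI.deg
        · refine hpop _ _ (fun x hx => ⟨hx, ?_⟩) (by simp [hr.one]) (by simp) (by simp)
          rintro rfl
          exact hdeg hx.2
        · simp [hr.one]; omega
    · apply runs_skip
      refine ⟨_, ⟨S, ⟨?_, ?_, ?_, ?_⟩, hS, rfl⟩, ?_⟩
      · exact hr.congr (by simp) (by simp) (by simp) (by simp) (by simp)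
      · simpa [AliveIs] using hI.alive
      · simpa using hI.deg
      · refine hpop _ _ (fun x hx => ⟨hx, ?_⟩) (by simp [hr.one]) (by simp) (by simp)
        rintro rfl
        exact hal (if_pos hx.1)
      · simp [hr.one]; omega
  · rintro t m s' ⟨S, hI, hS, rfl⟩ hg ht
    refine ⟨⟨S, hI.ready, hI.alive, fun v hv h => ?_, hS⟩, by omega⟩
    obtain ⟨p, h1, h2, -⟩ := hI.queued.mem v ⟨hv, h⟩
    exact hg (h1.trans_lt h2)

theorem listLength_eq_card_nbrsIn (G : SimpleGraph (Fin n)) (v : Fin n) :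
    listLength G v = (nbrsIn G Finset.univ v).card := by
  rw [listLength, ← Set.ncard_coe_finset]
  congr 1
  ext w
  simp [mem_nbrsIn]

theorem sum_listLength (G : SimpleGraph (Fin n)) :
    ∑ v, listLength G v = 2 * G.edgeSet.ncard := by
  classical
  rw [← SimpleGraph.coe_edgeFinset, Set.ncard_coe_finset, ← G.sum_degrees_eq_twice_card_edges]
  refine Finset.sum_congr rfl fun v _ => ?_
  rw [listLength, Set.ncard_eq_toFinset_card', ← SimpleGraph.neighborFinset_def,
    SimpleGraph.card_neighborFinset_eq_degree]

theorem le_two_mul_ncard_edgeSet (h : ∀ v : Fin n, ∃ w, G.Adj v w) :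
    n ≤ 2 * G.edgeSet.ncard := by
  rw [← sum_listLength]
  calc n = ∑ _v : Fin n, 1 := by simp
    _ ≤ _ := Finset.sum_le_sum fun v _ => (Set.ncard_pos (Set.toFinite _)).2 (h v)

theorem runs_algorithm (hG : IsUnicyclic G) {s : Memory} (hs : IsInput G s) :
    Runs algorithm s fun t s' =>
      (s'.reg .ans = 1 ∧ HasUniquePerfectMatching G ∨
        s'.reg .ans = 0 ∧ ¬ HasUniquePerfectMatching G) ∧
      t ≤ 47 * n + 40 * G.edgeSet.ncard + 13 := by
  apply runs_seq; apply runs_const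
  apply runs_seq; apply runs_const
  apply runs_seq
  refine (runs_initVertices (G := G) ⟨hs.congr ?_ ?_ ?_, ?_, ?_⟩).mono ?_
  iterate 5 simp
  rintro t₁ s₁ ⟨h₁, ht₁⟩
  apply runs_seq
  refine (runs_initQueue h₁).mono ?_
  rintro t₂ s₂ ⟨h₂, hq, htl, ht₂⟩
  apply runs_seq; apply runs_const
  apply runs_seq
  refine (runs_mainLoop (G := G) ⟨?_, ?_, ?_, ?_, ?_, ?_⟩).mono ?_
  · exact h₂.ready.congr (by simp) (by simp) (by simp) (by simp) (by simp)
  · simpa [AliveIs] using h₂.alive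
  · simpa [← listLength_eq_card_nbrsIn] using h₂.deg
  · simpa using hq.head_le
  · simpa using hq.lt
  · simpa [← listLength_eq_card_nbrsIn] using hq.mem
  rintro t₃ s₃ ⟨⟨S, hr, hal, hleaf, hS⟩, ht₃⟩
  refine (runs_testEmpty hr hal).mono ?_
  rintro t₄ s₄ ⟨hans, ht₄⟩
  refine ⟨hans.imp (fun h => ⟨h.1, ?_⟩) fun h => ⟨h.1, ?_⟩, ?_⟩
  · rw [← hS, h.2]
    exact existsUnique_isMatchingMap_empty G
  · rw [← hS]
    exact hG.not_existsUnique_isMatchingMap h.2 hleaf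
  · rw [Finset.sum_add_distrib, sum_listLength] at ht₃
    simp at ht₃
    omega

end MainLoop
end UPM

theorem corollary2 :
    ∃ C : ℕ, ∀ (n : ℕ) (G : SimpleGraph (Fin n)), UPM.IsUnicyclic G →
      ∀ s : UPM.Memory, UPM.IsInput G s →
        ∃ (t : ℕ) (s' : UPM.Memory), UPM.Exec UPM.algorithm s t s' ∧
          (s'.reg .ans = 1 ∧ UPM.HasUniquePerfectMatching G ∨
            s'.reg .ans = 0 ∧ ¬ UPM.HasUniquePerfectMatching G) ∧
          t ≤ C * (n + G.edgeSet.ncard) ∧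
          ((∀ v : Fin n, ∃ w : Fin n, G.Adj v w) → t ≤ C * G.edgeSet.ncard) := by
  refine ⟨180, fun n G hG s hs => ?_⟩
  obtain ⟨t, s', he, hans, ht⟩ := UPM.runs_algorithm hG hs
  -- The cycle supplies a vertex, so the additive constant 13 is absorbed by `n`; without isolated
  -- vertices, `n ≤ 2m` then absorbs everything into `m`.
  have hn : 0 < n := by
    obtain ⟨H, ⟨v, -⟩, -⟩ := hG
    exact v.pos
  refine ⟨t, s', he, hans, by omega, fun h => ?_⟩
  have := UPM.le_two_mul_ncard_edgeSet h
  omega
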